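/- **Setting.** Let $\Theta\subset\mathbb R^d$ be a bounded, convex, open parameter set (for example an open ball) and $\ell(\theta;x,y)$, $\theta\in\mathbb R^d$, $x\in\mathbb R^p$, $y\in\{0,1\}$, a loss that is measurable in $x$ and differentiable in $\theta\in\Theta$, and which together with $\nabla_\theta\ell$ is bounded on bounded sets of $(\theta,x)$, $\theta\in\Theta$. Let $\mathcal P_0,\mathcal P_1$ be the fixed class-conditional distributions (majority $y=0$, minority $y=1$), and for each pair of sample sizes $n_1<n_0$ let $\mathcal P_{\rm syn}=\mathcal P_{{\rm syn},n_0,n_1}$ be a generator distribution and $\tilde n=\tilde n(n_0,n_1)\in\mathbb N$ a synthetic size. Put $\pi_0=\frac{n_0}{n_0+n_1+\tilde n}$, $\pi_1=\frac{n_1}{n_0+n_1+\tilde n}$, $\tilde\pi=\frac{\tilde n}{n_0+n_1+\tilde n}$ and $$\mathcal R(\theta)=\tfrac12\mathbb E_{\mathcal P_0}\ell(\theta;x,0)+\tfrac12\mathbb E_{\mathcal P_1}\ell(\theta;x,1),\qquad \tilde{\mathcal R}(\theta)=\pi_0\mathbb E_{\mathcal P_0}\ell(\theta;x,0)+\pi_1\mathbb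 E_{\mathcal P_1}\ell(\theta;x,1)+\tilde\pi\,\mathbb E_{\mathcal P_{\rm syn}}\ell(\theta;x,1),$$ $$\phi(\theta)=\mathbb E_{\mathcal P_0}\ell(\theta;x,0)-\mathbb E_{\mathcal P_1}\ell(\theta;x,1),\qquad \psi(\theta)=\mathbb E_{\mathcal P_{\rm syn}}\ell(\theta;x,1)-\mathbb E_{\mathcal P_1}\ell(\theta;x,1).$$ Let $\theta^*$ and $\tilde\theta$ be minimizers over $\Theta$ of $\mathcal R$ and $\tilde{\mathcal R}$. For each $(n_0,n_1)$ draw $n_0$ points from $\mathcal P_0$ (label $0$), $n_1$ from $\mathcal P_1$ (label $1$) and $\tilde n$ from $\mathcal P_{\rm syn}$ (label $1$), all independent, and let $\hat\theta$ be, with probability tending to one, a minimizer over $\Theta$ of the average loss $\hat{\mathcal R}$ over these $n_0+n_1+\tilde n$ points. Let $\Sigma_0,\Sigma_1,\tilde\Sigma$ be the covariances of $\nabla_\theta\ell(\theta;x,0)$ under $\mathcal P_0$, of $\nabla_\theta\ell(\theta;x,1)$ under $\mathcal P_1$, and of $\nabla_\theta\ell(\theta;x,1)$ under $\mathcal P_{\rm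 syn}$, and $\Sigma=\pi_0\Sigma_0+\pi_1\Sigma_1+\tilde\pi\tilde\Sigma$. All limits and orders are as $n_0,n_1\to\infty$ with $n_1<n_0$. **Assumptions** (constants are positive and do not depend on $n_0,n_1$; conditions involving $(n_0,n_1)$ hold for all large $n_0,n_1$). $\mathcal R,\phi,\psi$ are twice differentiable on $\Theta$, and for all $\theta\in\Theta$: * (A1) $\mathcal R(\theta^*)\ge\mathcal R(\theta)+\nabla\mathcal R(\theta)^\top(\theta^*-\theta)+\frac\mu2\|\theta^*-\theta\|^2$ and $\mathcal R(\theta)-\mathcal R(\theta^*)\ge L\|\theta-\theta^*\|^2$; * (A2) $\mathcal P_0,\mathcal P_1,\mathcal P_{\rm syn}$ are supported in a common bounded set; * (A3) $\nabla^2\tilde{\mathcal R}(\theta)\succeq\lambda I$ and $\|\nabla^2\tilde{\mathcal R}(\theta)-\nabla^2\tilde{\mathcal R}(\tilde\theta)\|\le L'\|\theta-\tilde\theta\|$; * (A4) $\lambda' I\prec\Sigma_0(\tilde\theta),\Sigma_1(\tilde\theta),\tilde\Sigma(\tilde\theta)\preceq\Lambda I$ and $\|\Sigma(\tilde\theta)-\Sigma(\theta^*)\|\le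 L''\|\tilde\theta-\theta^*\|$; * (A5) $\|(\pi_0-\frac12)\nabla^2\phi(\theta)+\tilde\pi\nabla^2\psi(\theta)\|\le C$. **Theorem.** Suppose in addition local symmetry, $\nabla\phi(\theta^*)=0$, and a realistic generator, $n_0^{-1/2}\ll\|\nabla\psi(\theta^*)\|\ll1$. 1. (Diminishing size.) If $\tilde n=O\big(\sqrt{n_0}/\|\nabla\psi(\theta^*)\|\big)$, then $\tilde n\ll n_0$ and $\mathcal R(\hat\theta)-\mathcal R(\theta^*)=O_P(n_0^{-1})$. 2. (Non-diminishing size.) If $\tilde n\gtrsim n_0$, then $\mathcal R(\hat\theta)-\mathcal R(\theta^*)=\Omega_P\big(\|\nabla\psi(\theta^*)\|^2\big)$, where $\|\nabla\psi(\theta^*)\|^2\gg n_0^{-1}$; in particular $n_0\,(\mathcal R(\hat\theta)-\mathcal R(\theta^*))\to\infty$ in probability. Here $X=O_P(a)$ means that for every $\varepsilon>0$ there is $C>0$ with $\mathbb P(|X|>Ca)\le\varepsilon$ for all large $n_0,n_1$, and $X=\Omega_P(a)$ that for every $\varepsilon>0$ there is $c>0$ with $\mathbb P(X<ca)\le\varepsilon$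 for all large $n_0,n_1$. -/

import Mathlib

open MeasureTheory ProbabilityTheory Filter Topology Asymptotics

noncomputable section

namespace SynAug

/-! Binary classification with covariates in `ℝᵖ`, labels in `Fin 2` (`0` is the majority class and
`1` the minority class), parameter in `ℝᵈ`, and a loss `loss θ x y`.
A pair `N = (n₀, n₁)` always records the two observed class sizes, and `m` is a synthetic size. -/

/-- Euclidean space of dimension `k`. -/
abbrev E (k : ℕ) := EuclideanSpace ℝ (Fin k)

/-- A loss `ℓ(θ; x, y)`. -/
abbrev Loss (d p : ℕ) := E d → E p → Fin 2 → ℝ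

section Risks

variable {d p : ℕ}

/-- `𝔼_Q ℓ(θ; x, y)`. -/
def classRisk (loss : Loss d p) (Q : Measure (E p)) (y : Fin 2) (θ : E d) : ℝ :=
  ∫ x, loss θ x y ∂Q

/-- The balanced population risk `R`. -/
def balancedRisk (loss : Loss d p) (P0 P1 : Measure (E p)) (θ : E d) : ℝ :=
  1 / 2 * classRisk loss P0 0 θ + 1 / 2 * classRisk loss P1 1 θ

/-- The total sample size `n₀ + n₁ + m`. -/
def total (N : ℕ × ℕ) (m : ℕ) : ℝ := (N.1 : ℝ) + N.2 + m

/-- Effective proportion of observed majority samples. -/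
def prop0 (N : ℕ × ℕ) (m : ℕ) : ℝ := N.1 / total N m

/-- Effective proportion of observed minority samples. -/
def prop1 (N : ℕ × ℕ) (m : ℕ) : ℝ := N.2 / total N m

/-- Effective proportion of synthetic samples. -/
def propSyn (N : ℕ × ℕ) (m : ℕ) : ℝ := m / total N m

/-- The synthetic population risk. -/
def synRisk (loss : Loss d p) (P0 P1 Psyn : Measure (E p)) (N : ℕ × ℕ) (m : ℕ) (θ : E d) : ℝ :=
  prop0 N m * classRisk loss P0 0 θ + prop1 N m * classRisk loss P1 1 θ
    + propSyn N m * classRisk loss Psyn 1 θ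

/-- The majority--minority asymmetry `φ`. -/
def phi (loss : Loss d p) (P0 P1 : Measure (E p)) (θ : E d) : ℝ :=
  classRisk loss P0 0 θ - classRisk loss P1 1 θ

/-- The synthetic-to-minority discrepancy `ψ`. -/
def psi (loss : Loss d p) (P1 Psyn : Measure (E p)) (θ : E d) : ℝ :=
  classRisk loss Psyn 1 θ - classRisk loss P1 1 θ

/-- Index set of the augmented sample: `n₀` majority, `n₁` minority, `m` synthetic points. -/
abbrev SampleIdx (N : ℕ × ℕ) (m : ℕ) := Fin N.1 ⊕ Fin N.2 ⊕ Fin m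

/-- The distribution from which the sample point with the given index is drawn. -/
def sampleLaw (P0 P1 Psyn : Measure (E p)) {N : ℕ × ℕ} {m : ℕ} : SampleIdx N m → Measure (E p)
  | .inl _ => P0
  | .inr (.inl _) => P1
  | .inr (.inr _) => Psyn

/-- The label attached to the sample point with the given index. -/
def sampleLabel {N : ℕ × ℕ} {m : ℕ} : SampleIdx N m → Fin 2
  | .inl _ => 0
  | .inr _ => 1

/-- The empirical augmented risk. -/
def empRisk (loss : Loss d p) {N : ℕ × ℕ} {m : ℕ} (x : SampleIdx N m → E p) (θ : E d) : ℝ :=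
  1 / total N m * ∑ i, loss θ (x i) (sampleLabel i)

/-- `θ` minimizes `f` over `Θ`. -/
def IsArgmin (f : E d → ℝ) (Θ : Set (E d)) (θ : E d) : Prop :=
  θ ∈ Θ ∧ IsMinOn f Θ θ

/-- The Hessian `∇²f(θ)`, as an operator on `ℝᵈ`; its norm is the spectral norm. -/
def hess (f : E d → ℝ) (θ : E d) : E d →L[ℝ] E d := fderiv ℝ (gradient f) θ

/-- `f` has a gradient and a Hessian at every point of `Θ`. -/
def TwiceDifferentiableOn (f : E d → ℝ) (Θ : Set (E d)) : Prop :=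
  ∀ θ ∈ Θ, DifferentiableAt ℝ f θ ∧ DifferentiableAt ℝ (gradient f) θ

/-- The Jacobian `∇b(θ) = (π₀ - 1/2) ∇²φ(θ) + π̃ ∇²ψ(θ)` of the first-order bias vector. -/
def biasJacobian (loss : Loss d p) (P0 P1 Psyn : Measure (E p)) (N : ℕ × ℕ) (m : ℕ) (θ : E d) :
    E d →L[ℝ] E d :=
  (prop0 N m - 1 / 2) • hess (phi loss P0 P1) θ + propSyn N m • hess (psi loss P1 Psyn) θ

/-- `Cov_Q(∇_θ ℓ(θ; x, y))`, as a bilinear form. -/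
def gradCov (loss : Loss d p) (Q : Measure (E p)) (y : Fin 2) (θ : E d) :
    E d →L[ℝ] E d →L[ℝ] ℝ :=
  covarianceBilin (Q.map fun x => gradient (fun t => loss t x y) θ)

/-- The weighted covariance `Σ(θ) = (n₀ Σ₀(θ) + n₁ Σ₁(θ) + m Σ̃(θ)) / (n₀ + n₁ + m)`. -/
def pooledCov (loss : Loss d p) (P0 P1 Psyn : Measure (E p)) (N : ℕ × ℕ) (m : ℕ) (θ : E d) :
    E d →L[ℝ] E d →L[ℝ] ℝ :=
  prop0 N m • gradCov loss P0 0 θ + prop1 N m • gradCov loss P1 1 θ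
    + propSyn N m • gradCov loss Psyn 1 θ

/-- All eigenvalues of the symmetric form `S` lie in `(a, b]`. -/
def SpectrumBetween (S : E d →L[ℝ] E d →L[ℝ] ℝ) (a b : ℝ) : Prop :=
  ∀ v : E d, v ≠ 0 → a * ‖v‖ ^ 2 < S v v ∧ S v v ≤ b * ‖v‖ ^ 2

end Risks

/-- The asymptotic regime `n₀, n₁ → ∞` with `n₁ < n₀`. -/
def regime : Filter (ℕ × ℕ) := (atTop ×ˢ atTop) ⊓ 𝓟 {N | N.2 < N.1}

section StochasticOrder

variable {Ω : ℕ × ℕ → Type*} [∀ N, MeasurableSpace (Ω N)]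

/-- `X = O_P(a)` for a nonnegative rate `a`. -/
def IsBigOP (Pr : ∀ N, Measure (Ω N)) (X : ∀ N, Ω N → ℝ) (a : ℕ × ℕ → ℝ) : Prop :=
  ∀ ε : ℝ, 0 < ε → ∃ C : ℝ, 0 < C ∧
    ∀ᶠ N in regime, Pr N {ω | C * a N < |X N ω|} ≤ ENNReal.ofReal ε

/-- `X = Ω_P(a)` for a nonnegative rate `a`: with probability arbitrarily close to one,
`X` is at least a positive constant times `a`. -/
def IsOmegaP (Pr : ∀ N, Measure (Ω N)) (X : ∀ N, Ω N → ℝ) (a : ℕ × ℕ → ℝ) : Prop :=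
  ∀ ε : ℝ, 0 < ε → ∃ c : ℝ, 0 < c ∧
    ∀ᶠ N in regime, Pr N {ω | X N ω < c * a N} ≤ ENNReal.ofReal ε

/-- `X ≫ a` in probability: `X / a → ∞` in probability. -/
def DominatesP (Pr : ∀ N, Measure (Ω N)) (X : ∀ N, Ω N → ℝ) (a : ℕ × ℕ → ℝ) : Prop :=
  ∀ K : ℝ, Tendsto (fun N => Pr N {ω | X N ω ≤ K * a N}) regime (𝓝 0)

end StochasticOrder

section Assumptions

variable {d p : ℕ}

/-- The loss is measurable in the covariate, differentiable in the parameter, and it and its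
gradient are bounded on bounded sets of parameters in `Θ` and covariates. -/
structure LossRegular (loss : Loss d p) (Θ : Set (E d)) : Prop where
  measurable : ∀ θ ∈ Θ, ∀ y, Measurable fun x => loss θ x y
  differentiable : ∀ θ ∈ Θ, ∀ x y, DifferentiableAt ℝ (fun t => loss t x y) θ
  bounded : ∀ r : ℝ, ∃ K : ℝ, ∀ θ ∈ Θ, ‖θ‖ ≤ r → ∀ x : E p, ‖x‖ ≤ r → ∀ y,
    |loss θ x y| ≤ K ∧ ‖gradient (fun t => loss t x y) θ‖ ≤ K

/-- The regularity conditions on the population quantities. `θs` is the balanced-risk minimizer and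
`θt N` the synthetic-risk minimizer; all constants are independent of the sample sizes. -/
structure RiskRegular (loss : Loss d p) (Θ : Set (E d)) (P0 P1 : Measure (E p))
    (Psyn : ℕ × ℕ → Measure (E p)) (m : ℕ × ℕ → ℕ) (θs : E d) (θt : ℕ × ℕ → E d) : Prop where
  /-- The gradients and Hessians occurring below exist. -/
  twice_balanced : TwiceDifferentiableOn (balancedRisk loss P0 P1) Θ
  twice_phi : TwiceDifferentiableOn (phi loss P0 P1) Θ
  twice_psi : ∀ᶠ N in regime, TwiceDifferentiableOn (psi loss P1 (Psyn N)) Θ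
  /-- Strong convexity of `R` relative to its minimizer. -/
  strong_convexity : ∃ μ : ℝ, 0 < μ ∧ ∀ θ ∈ Θ,
    balancedRisk loss P0 P1 θ + inner ℝ (gradient (balancedRisk loss P0 P1) θ) (θs - θ)
      + μ / 2 * ‖θs - θ‖ ^ 2 ≤ balancedRisk loss P0 P1 θs
  /-- Quadratic growth of `R` at its minimizer. -/
  quadratic_growth : ∃ L : ℝ, 0 < L ∧ ∀ θ ∈ Θ,
    L * ‖θ - θs‖ ^ 2 ≤ balancedRisk loss P0 P1 θ - balancedRisk loss P0 P1 θs
  /-- Bounded covariates (so that all their moments are finite as well). -/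
  bounded_support : ∃ B : ℝ, (∀ᵐ x ∂P0, ‖x‖ ≤ B) ∧ (∀ᵐ x ∂P1, ‖x‖ ≤ B) ∧
    ∀ᶠ N in regime, ∀ᵐ x ∂(Psyn N), ‖x‖ ≤ B
  /-- `∇²R̃(θ) ⪰ lam I` on `Θ`. -/
  hess_lower : ∃ lam : ℝ, 0 < lam ∧ ∀ᶠ N in regime, ∀ θ ∈ Θ, ∀ v : E d,
    lam * ‖v‖ ^ 2 ≤ inner ℝ (hess (synRisk loss P0 P1 (Psyn N) N (m N)) θ v) v
  /-- `∇²R̃` is Lipschitz at the minimizer of `R̃`. -/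
  hess_lipschitz : ∃ L : ℝ, 0 < L ∧ ∀ᶠ N in regime, ∀ θ ∈ Θ,
    ‖hess (synRisk loss P0 P1 (Psyn N) N (m N)) θ
      - hess (synRisk loss P0 P1 (Psyn N) N (m N)) (θt N)‖ ≤ L * ‖θ - θt N‖
  /-- Nondegenerate and bounded gradient covariances at the minimizer of `R̃`. -/
  cov_spectrum : ∃ lam lamMax : ℝ, 0 < lam ∧ ∀ᶠ N in regime,
    SpectrumBetween (gradCov loss P0 0 (θt N)) lam lamMax ∧
    SpectrumBetween (gradCov loss P1 1 (θt N)) lam lamMax ∧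
    SpectrumBetween (gradCov loss (Psyn N) 1 (θt N)) lam lamMax
  /-- Lipschitz comparison of the pooled covariances at the two minimizers. -/
  cov_lipschitz : ∃ L : ℝ, 0 < L ∧ ∀ᶠ N in regime,
    ‖pooledCov loss P0 P1 (Psyn N) N (m N) (θt N)
      - pooledCov loss P0 P1 (Psyn N) N (m N) θs‖ ≤ L * ‖θt N - θs‖
  /-- Finite gradient of the total bias. -/
  bias_bounded : ∃ C : ℝ, ∀ᶠ N in regime, ∀ θ ∈ Θ,
    ‖biasJacobian loss P0 P1 (Psyn N) N (m N) θ‖ ≤ C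

end Assumptions

end SynAug

end

open SynAug

/-! The augmented risk is a perturbation of the balanced one, `R̃ = R + (π₀ - 1/2) φ + π̃ ψ`
(`synRisk_eq`). At `θs` the gradients of `R` and `φ` vanish, so `∇R̃(θs) = π̃ ∇ψ(θs)`. The Hessian
of `R̃` is bounded below by assumption and above by `exists_hess_synRisk_bound`, so the bias `‖θt -
θs‖` is comparable to `π̃ ‖∇ψ(θs)‖` (`exists_norm_sub_bounds`).

The statistical error `‖θhat - θt‖` is `O_P(n₀^{-1/2})` (`exists_empirical_minimizer_rate`). The
population risk grows quadratically around `θt`, and an empirical minimizer far away would need a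
centred-risk fluctuation of that size. Hoeffding's inequality gives sub-Gaussian increments of scale
`K / √n`, `n` being the total sample size. Chaining inside balls and peeling over dyadic shells
(`exists_measure_quadratic_le`) then confine such fluctuations to radius `O_P(n^{-1/2})`.

The excess balanced risk lies between multiples of `‖θhat - θs‖²`, so only the triangle inequality
remains. A small synthetic size makes the bias `O(n₀^{-1/2})`, matching the statistical error; a
large one keeps `π̃` away from zero, and the bias, of order at least `‖∇ψ(θs)‖ ≫ n₀^{-1/2}`,
dominates. -/

namespace SynAug

/-! ### Hessian bounds and the decomposition of the augmented risk. -/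

section Convexity

lemma le_of_hasDerivAt_nonneg {f f' : ℝ → ℝ} (hf : ∀ s ∈ Set.Icc (0 : ℝ) 1, HasDerivAt f (f' s) s)
    (h0 : ∀ s ∈ Set.Icc (0 : ℝ) 1, 0 ≤ f' s) : f 0 ≤ f 1 := by
  refine monotoneOn_of_deriv_nonneg (convex_Icc (0 : ℝ) 1)
    (fun s hs => (hf s hs).continuousAt.continuousWithinAt)
    (fun s hs => (hf s (interior_subset hs)).differentiableAt.differentiableWithinAt)
    (fun s hs => ?_) (by simp) (by simp) zero_le_one
  rw [(hf s (interior_subset hs)).deriv]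
  exact h0 s (interior_subset hs)

variable {d : ℕ} {f : E d → ℝ} {Θ : Set (E d)} {θ θ₀ : E d}

lemma IsArgmin.gradient_eq_zero (h : IsArgmin f Θ θ) (hΘ : IsOpen Θ) : gradient f θ = 0 := by
  have : fderiv ℝ f θ = 0 := (h.2.isLocalMin (hΘ.mem_nhds h.1)).fderiv_eq_zero
  simp [gradient, this]

lemma lineSegment_mem (hΘ : Convex ℝ Θ) (h₀ : θ₀ ∈ Θ) (h : θ ∈ Θ) {s : ℝ}
    (hs : s ∈ Set.Icc (0 : ℝ) 1) : θ₀ + s • (θ - θ₀) ∈ Θ :=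
  hΘ.add_smul_sub_mem h₀ h hs

lemma hasDerivAt_lineSegment (θ₀ v : E d) (s : ℝ) :
    HasDerivAt (fun s : ℝ => θ₀ + s • v) v s := by
  simpa using ((hasDerivAt_id s).smul_const v).const_add θ₀

/-- A lower bound on the Hessian makes the gradient strongly monotone. -/
lemma mul_sq_norm_le_inner_gradient_sub (hΘ : Convex ℝ Θ) {lam : ℝ}
    (hd : ∀ θ ∈ Θ, DifferentiableAt ℝ (gradient f) θ)
    (hlow : ∀ θ ∈ Θ, ∀ v : E d, lam * ‖v‖ ^ 2 ≤ inner ℝ (hess f θ v) v)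
    (h₀ : θ₀ ∈ Θ) (h : θ ∈ Θ) :
    lam * ‖θ - θ₀‖ ^ 2 ≤ inner ℝ (gradient f θ - gradient f θ₀) (θ - θ₀) := by
  set v := θ - θ₀ with hv
  have key := le_of_hasDerivAt_nonneg
    (f := fun s => inner ℝ (gradient f (θ₀ + s • v)) v - s * (lam * ‖v‖ ^ 2))
    (f' := fun s => inner ℝ (hess f (θ₀ + s • v) v) v - lam * ‖v‖ ^ 2)
    (fun s hs => by
      have h1 : HasDerivAt (fun s : ℝ => gradient f (θ₀ + s • v)) (hess f (θ₀ + s • v) v) s := by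
        have := (hd _ (lineSegment_mem hΘ h₀ h hs)).hasFDerivAt.comp_hasDerivAt s
          (hasDerivAt_lineSegment θ₀ v s)
        exact this
      have h2 := (h1.inner ℝ (hasDerivAt_const s v)).sub
        ((hasDerivAt_id s).mul_const (lam * ‖v‖ ^ 2))
      refine HasDerivAt.congr_deriv h2 ?_
      simp only [inner_zero_right, zero_add, one_mul])
    (fun s hs => sub_nonneg.2 (hlow _ (lineSegment_mem hΘ h₀ h hs) v))
  have hθ : θ₀ + v = θ := by simp [hv]
  simp only [zero_smul, add_zero, zero_mul, sub_zero, one_smul, one_mul, hθ] at key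
  rw [inner_sub_left]
  linarith

/-- A lower bound on the Hessian gives quadratic growth at a critical point. -/
lemma half_mul_sq_norm_le_sub (hΘ : Convex ℝ Θ) {lam : ℝ} (hf : TwiceDifferentiableOn f Θ)
    (hlow : ∀ θ ∈ Θ, ∀ v : E d, lam * ‖v‖ ^ 2 ≤ inner ℝ (hess f θ v) v)
    (h₀ : θ₀ ∈ Θ) (h : θ ∈ Θ) (hg : gradient f θ₀ = 0) :
    lam / 2 * ‖θ - θ₀‖ ^ 2 ≤ f θ - f θ₀ := by
  set v := θ - θ₀ with hv
  have key := le_of_hasDerivAt_nonneg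
    (f := fun s => f (θ₀ + s • v) - s ^ 2 * (lam / 2 * ‖v‖ ^ 2))
    (f' := fun s => inner ℝ (gradient f (θ₀ + s • v)) v - 2 * s * (lam / 2 * ‖v‖ ^ 2))
    (fun s hs => by
      have h1 : HasDerivAt (fun s : ℝ => f (θ₀ + s • v))
          (inner ℝ (gradient f (θ₀ + s • v)) v) s := by
        have := (hf _ (lineSegment_mem hΘ h₀ h hs)).1.hasFDerivAt.comp_hasDerivAt s
          (hasDerivAt_lineSegment θ₀ v s)
        rwa [← inner_gradient_left] at this
      have h2 := h1.sub (((hasDerivAt_id s).pow 2).mul_const (lam / 2 * ‖v‖ ^ 2))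
      refine HasDerivAt.congr_deriv h2 ?_
      simp)
    (fun s hs => by
      have hm := mul_sq_norm_le_inner_gradient_sub hΘ (fun θ hθ => (hf θ hθ).2) hlow h₀
        (lineSegment_mem hΘ h₀ h hs)
      rw [hg, sub_zero, add_sub_cancel_left, ← hv, inner_smul_right, norm_smul,
        Real.norm_of_nonneg hs.1] at hm
      -- Monotonicity was applied to the displacement `s • v`, so both sides of `hm` carry a factor
      -- `s` to be cancelled.
      rcases hs.1.eq_or_lt with rfl | hpos
      · simp [hg]
      · have : s * (lam * s * ‖v‖ ^ 2) ≤ s * inner ℝ (gradient f (θ₀ + s • v)) v := by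
          linarith
        have := le_of_mul_le_mul_left this hpos
        linarith)
  have hθ : θ₀ + v = θ := by simp [hv]
  simp only [zero_smul, add_zero, one_smul, hθ] at key
  linarith

lemma gradient_add_mul_add_mul {f g h : E d → ℝ} (hf : DifferentiableAt ℝ f θ)
    (hg : DifferentiableAt ℝ g θ) (hh : DifferentiableAt ℝ h θ) (a b : ℝ) :
    gradient (fun θ => f θ + a * g θ + b * h θ) θ
      = gradient f θ + a • gradient g θ + b • gradient h θ := by
  refine HasGradientAt.gradient ?_
  rw [hasGradientAt_iff_hasFDerivAt]
  have := (hf.hasFDerivAt.add (hg.hasFDerivAt.const_mul a)).add (hh.hasFDerivAt.const_mul b)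
  refine HasFDerivAt.congr_fderiv this ?_
  simp [gradient]

/-- Openness of `Θ` matters: the Hessian differentiates the gradient field, so the gradient identity
is needed on a neighbourhood of each point. -/
lemma TwiceDifferentiableOn.add_mul_add_mul {f g h : E d → ℝ} (hΘ : IsOpen Θ)
    (hf : TwiceDifferentiableOn f Θ) (hg : TwiceDifferentiableOn g Θ)
    (hh : TwiceDifferentiableOn h Θ) (a b : ℝ) :
    TwiceDifferentiableOn (fun θ => f θ + a * g θ + b * h θ) Θ ∧
    ∀ θ ∈ Θ, hess (fun θ => f θ + a * g θ + b * h θ) θ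
      = hess f θ + (a • hess g θ + b • hess h θ) := by
  have key : ∀ θ ∈ Θ, HasFDerivAt (gradient fun θ => f θ + a * g θ + b * h θ)
      (hess f θ + (a • hess g θ + b • hess h θ)) θ := by
    intro θ hθ
    have e : (gradient fun θ => f θ + a * g θ + b * h θ) =ᶠ[𝓝 θ]
        fun θ => gradient f θ + (a • gradient g θ + b • gradient h θ) := by
      filter_upwards [hΘ.mem_nhds hθ] with t ht
      rw [gradient_add_mul_add_mul (hf t ht).1 (hg t ht).1 (hh t ht).1, add_assoc]
    exact ((hf θ hθ).2.hasFDerivAt.add (((hg θ hθ).2.hasFDerivAt.const_smul a).add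
      ((hh θ hθ).2.hasFDerivAt.const_smul b))).congr_of_eventuallyEq e
  exact ⟨fun θ hθ => ⟨((hf θ hθ).1.add ((hg θ hθ).1.const_mul a)).add ((hh θ hθ).1.const_mul b),
    (key θ hθ).differentiableAt⟩, fun θ hθ => (key θ hθ).fderiv⟩

/-- A bound on the Hessian makes the gradient Lipschitz. -/
lemma norm_gradient_sub_le (hΘ : Convex ℝ Θ) (hf : TwiceDifferentiableOn f Θ) {M : ℝ}
    (hM : ∀ θ ∈ Θ, ‖hess f θ‖ ≤ M) (h₀ : θ₀ ∈ Θ) (h : θ ∈ Θ) :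
    ‖gradient f θ - gradient f θ₀‖ ≤ M * ‖θ - θ₀‖ :=
  hΘ.norm_image_sub_le_of_norm_fderiv_le (fun θ hθ => (hf θ hθ).2) hM h₀ h

/-- The three weights sum to one, which eliminates `π₁`. -/
lemma synRisk_eq {p : ℕ} (loss : Loss d p) (P0 P1 Psyn : Measure (E p)) (N : ℕ × ℕ) (m : ℕ)
    (hN : total N m ≠ 0) : synRisk loss P0 P1 Psyn N m = fun θ =>
      balancedRisk loss P0 P1 θ + (prop0 N m - 1 / 2) * phi loss P0 P1 θ
        + propSyn N m * psi loss P1 Psyn θ := by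
  have h1 : prop0 N m + prop1 N m + propSyn N m = 1 := by
    unfold prop0 prop1 propSyn
    rw [← add_div, ← add_div]
    exact div_self hN
  funext θ
  simp only [synRisk, balancedRisk, phi, psi]
  linear_combination classRisk loss P1 1 θ * h1

end Convexity

/-! ### Suprema of sub-Gaussian processes. -/

section Chaining

/-- A subset of a ball of radius `δ` has an internal net of mesh `√d * δ / 2 ^ n` with at most
`4 ^ (n + 1)` points per dimension. -/
lemma exists_finite_net {d : ℕ} {S : Set (E d)} {θ₀ : E d} {δ : ℝ} (hδ : 0 < δ)
    (hS : ∀ θ ∈ S, ‖θ - θ₀‖ ≤ δ) (n : ℕ) :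
    ∃ (T : Finset (E d)) (proj : E d → E d), T.card ≤ (4 ^ (n + 1)) ^ d ∧
      ∀ θ ∈ S, proj θ ∈ S ∧ proj θ ∈ T ∧ ‖proj θ - θ‖ ≤ √d * δ / 2 ^ n := by
  classical
  -- `q` indexes grid cells of side `δ / 2 ^ n`. Each cell meeting `S` is represented by a point of
  -- `S`, so the net is internal; the default `θ₀` serves only cells missing `S`.
  let q : E d → Fin d → ℤ := fun θ i => ⌊2 ^ n * (θ i - θ₀ i) / δ⌋
  let rep : (Fin d → ℤ) → E d := fun c => if h : ∃ θ ∈ S, q θ = c then h.choose else θ₀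
  have hrep : ∀ θ ∈ S, rep (q θ) ∈ S ∧ q (rep (q θ)) = q θ := by
    intro θ hθ
    have h : ∃ θ' ∈ S, q θ' = q θ := ⟨θ, hθ, rfl⟩
    simp only [rep, dif_pos h]
    exact h.choose_spec
  refine ⟨(Fintype.piFinset fun _ : Fin d => Finset.Icc (-2 ^ n : ℤ) (2 ^ n)).image rep,
    fun θ => rep (q θ), ?_, fun θ hθ => ⟨(hrep θ hθ).1, ?_, ?_⟩⟩
  · refine Finset.card_image_le.trans ?_
    rw [Fintype.card_piFinset_const, Int.card_Icc]
    refine Nat.pow_le_pow_left ?_ d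
    have h1 : (1 : ℤ) ≤ 2 ^ n := one_le_pow₀ (by norm_num)
    have h2 : (4 : ℤ) ^ (n + 1) = 4 * (2 ^ n * 2 ^ n) := by
      rw [pow_succ, show (4 : ℤ) = 2 * 2 by norm_num, mul_pow]; ring
    zify
    rw [Int.toNat_of_nonneg (by linarith), h2]
    nlinarith
  · refine Finset.mem_image_of_mem _ (Fintype.mem_piFinset.2 fun i => ?_)
    have hi : |θ i - θ₀ i| ≤ δ := by
      have := (PiLp.norm_apply_le (θ - θ₀) i).trans (hS θ hθ)
      simpa using this
    obtain ⟨hl, hu⟩ := abs_le.1 hi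
    have h2 : (0 : ℝ) < 2 ^ n := by positivity
    rw [Finset.mem_Icc]
    constructor
    · refine Int.le_floor.2 ?_
      push_cast
      rw [le_div_iff₀ hδ]
      nlinarith
    · have : (⌊2 ^ n * (θ i - θ₀ i) / δ⌋ : ℝ) ≤ 2 ^ n := by
        refine (Int.floor_le _).trans ?_
        rw [div_le_iff₀ hδ]
        nlinarith
      exact_mod_cast this
  · have hi : ∀ i, ‖(rep (q θ) - θ) i‖ ≤ δ / 2 ^ n := by
      intro i
      have h := Int.abs_sub_lt_one_of_floor_eq_floor (congrFun (hrep θ hθ).2 i)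
      have h2 : (0 : ℝ) < 2 ^ n := by positivity
      have e : 2 ^ n * (rep (q θ) i - θ₀ i) / δ - 2 ^ n * (θ i - θ₀ i) / δ
          = (rep (q θ) i - θ i) * (2 ^ n / δ) := by ring
      rw [e, abs_mul, abs_of_pos (div_pos h2 hδ)] at h
      rw [le_div_iff₀ h2]
      have := mul_lt_mul_of_pos_right h hδ
      rw [mul_assoc, div_mul_cancel₀ _ hδ.ne', one_mul] at this
      simpa using this.le
    rw [EuclideanSpace.norm_eq]
    calc √(∑ i, ‖(rep (q θ) - θ) i‖ ^ 2) ≤ √(∑ _i : Fin d, (δ / 2 ^ n) ^ 2) :=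
          Real.sqrt_le_sqrt (Finset.sum_le_sum fun i _ => by gcongr; exact hi i)
      _ = √d * δ / 2 ^ n := by
          rw [Finset.sum_const, Finset.card_univ, Fintype.card_fin, nsmul_eq_mul,
            Real.sqrt_mul (Nat.cast_nonneg d), Real.sqrt_sq (by positivity), mul_div_assoc]

universe u

/-- The process `G` has sub-Gaussian increments on `S` with scale `σ`. -/
def SubGaussianIncrements {d : ℕ} {Ω : Type u} [MeasurableSpace Ω] (P : Measure Ω)
    (G : E d → Ω → ℝ) (S : Set (E d)) (σ : ℝ) : Prop :=
  ∀ θ ∈ S, ∀ θ' ∈ S, ∀ D : ℝ, 0 < D → ‖θ - θ'‖ ≤ D → ∀ s : ℝ, 0 ≤ s →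
    P {ω | s ≤ |G θ ω - G θ' ω|} ≤ ENNReal.ofReal (2 * Real.exp (-s ^ 2 / (2 * (σ * D) ^ 2)))

/-- The constant `(2 + 4 √d)²` of the chaining bound. -/
noncomputable def chainConst (d : ℕ) : ℝ := (2 + 4 * √d) ^ 2

lemma chainConst_pos (d : ℕ) : 0 < chainConst d := by
  unfold chainConst; positivity

lemma tsum_ofReal_geometric_le {b r : ℝ} (hb : 0 ≤ b) (hr : 0 ≤ r) (hr' : r ≤ 1 / 2) :
    ∑' k : ℕ, ENNReal.ofReal (b * r ^ (k + 1)) ≤ ENNReal.ofReal (2 * b * r) := by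
  have hs : Summable fun k : ℕ => b * r ^ (k + 1) := by
    simp_rw [pow_succ']
    exact ((summable_geometric_of_lt_one hr (by linarith)).mul_left r).mul_left b
  rw [← ENNReal.ofReal_tsum_of_nonneg (fun k => by positivity) hs]
  refine ENNReal.ofReal_le_ofReal ?_
  simp_rw [pow_succ']
  rw [tsum_mul_left, tsum_mul_left, tsum_geometric_of_lt_one hr (by linarith)]
  have : (1 - r)⁻¹ ≤ 2 := by
    rw [inv_le_comm₀ (by linarith) (by norm_num)]; linarith
  calc b * (r * (1 - r)⁻¹) ≤ b * (r * 2) := by gcongr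
    _ = 2 * b * r := by ring

variable {d : ℕ} {Ω : Type u} [MeasurableSpace Ω] {P : Measure Ω} {G : E d → Ω → ℝ}
  {S : Set (E d)} {σ : ℝ}

/-- Deterministic chaining: a path that is continuous and has small increments along the links of
a chain has a small total increment. -/
lemma abs_sub_le_of_chain {g : E d → ℝ} (hg : ContinuousOn g S) {c : ℕ → E d} {θ : E d}
    (hθ : θ ∈ S) (hc : ∀ k, c k ∈ S) (hlim : Tendsto c atTop (𝓝 θ)) {a : ℝ} (ha : 0 ≤ a)
    (h : ∀ k, |g (c k) - g (c (k + 1))| ≤ a * (3 / 4) ^ k) : |g θ - g (c 0)| ≤ 4 * a := by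
  have hb : ∀ k, |g (c k) - g (c 0)| ≤ 4 * a * (1 - (3 / 4) ^ k) := by
    intro k
    induction k with
    | zero => simp
    | succ k ih =>
      have := abs_sub_le (g (c (k + 1))) (g (c k)) (g (c 0))
      have hk := h k
      rw [abs_sub_comm] at hk
      rw [pow_succ]
      linarith
  have hl : Tendsto (fun k => |g (c k) - g (c 0)|) atTop (𝓝 |g θ - g (c 0)|) :=
    (((hg θ hθ).tendsto.comp
      (tendsto_nhdsWithin_iff.2 ⟨hlim, Eventually.of_forall hc⟩)).sub_const _).abs
  refine le_of_tendsto' hl fun k => (hb k).trans ?_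
  have : (0 : ℝ) ≤ (3 / 4) ^ k := by positivity
  nlinarith

/-- **Chaining bound**: tail of the supremum, over a subset of a ball of radius `δ`, of a process
with sub-Gaussian increments and continuous paths. -/
theorem measure_exists_lt_abs_sub_le [IsProbabilityMeasure P] (hσ : 0 < σ)
    (hG : SubGaussianIncrements P G S σ)
    (hcont : ∀ᵐ ω ∂P, ContinuousOn (fun θ => G θ ω) S) {θ₀ : E d} (h₀ : θ₀ ∈ S) {δ : ℝ}
    (hδ : 0 < δ) (hS : ∀ θ ∈ S, ‖θ - θ₀‖ ≤ δ) {u : ℝ} (hu : 0 ≤ u) :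
    P {ω | ∃ θ ∈ S, u * δ * σ < |G θ ω - G θ₀ ω|}
      ≤ ENNReal.ofReal (4 * (16 ^ d * Real.exp (-(u ^ 2 / (32 * chainConst d))))) := by
  classical
  set w := u ^ 2 / (32 * chainConst d) with hw
  set ρ := (16 : ℝ) ^ d * Real.exp (-w) with hρ
  -- For `ρ > 1/2` the claimed bound exceeds one; otherwise `ρ` is a usable geometric ratio.
  rcases lt_or_ge (1 / 2) ρ with hbig | hsmall
  · exact prob_le_one.trans (ENNReal.one_le_ofReal.2 (by linarith))
  choose T' proj hT' hproj using exists_finite_net (θ₀ := θ₀) hδ hS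
  let c : E d → ℕ → E d := fun θ k => Nat.casesOn k θ₀ fun n => proj n θ
  let T : ℕ → Finset (E d) := fun k => Nat.casesOn k {θ₀} fun n => T' n
  -- With this `A`, the distance from `c θ k` to `θ` is at most `D k / 2` both at level zero (`δ`)
  -- and at later levels (net mesh), so consecutive links have length at most `D k`.
  let A : ℝ := 2 + 4 * √d
  have hA : 0 < A := by positivity
  let D : ℕ → ℝ := fun k => A * δ / 2 ^ k
  have hD : ∀ k, 0 < D k := fun k => by positivity
  -- The thresholds sum to `u * δ * σ`, yet decay more slowly than `D k`: the ratio `s k / D k`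
  -- grows like `(3 / 2) ^ k`, giving the Gaussian exponent `w * (9 / 4) ^ k`.
  let s : ℕ → ℝ := fun k => u * δ * σ / 4 * (3 / 4) ^ k
  have hs : ∀ k, 0 ≤ s k := fun k => by positivity
  have hTcard : ∀ k, (T k).card ≤ (4 ^ k) ^ d := by
    rintro (_ | k)
    · simp [T]
    · exact hT' k
  have hcS : ∀ θ ∈ S, ∀ k, c θ k ∈ S := by
    rintro θ hθ (_ | k)
    · exact h₀
    · exact (hproj k θ hθ).1
  have hcT : ∀ θ ∈ S, ∀ k, c θ k ∈ T k := by
    rintro θ hθ (_ | k)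
    · simp [c, T]
    · exact (hproj k θ hθ).2.1
  have hcd : ∀ θ ∈ S, ∀ k, ‖c θ k - θ‖ ≤ A * δ / 2 ^ k / 2 := by
    rintro θ hθ (_ | k)
    · have h1 := hS θ hθ
      rw [norm_sub_rev] at h1
      have h2 : 0 ≤ √(d : ℝ) * δ := by positivity
      change ‖θ₀ - θ‖ ≤ A * δ / 2 ^ 0 / 2
      simp only [A, pow_zero, div_one]
      linarith
    · refine ((hproj k θ hθ).2.2).trans ?_
      have e : A * δ / 2 ^ (k + 1) / 2 = √d * δ / 2 ^ k + δ / 2 ^ k / 2 := by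
        simp only [A]; rw [pow_succ]; field_simp; ring
      rw [e]
      have : 0 ≤ δ / 2 ^ k / 2 := by positivity
      linarith
  have hlink : ∀ θ ∈ S, ∀ k, ‖c θ k - c θ (k + 1)‖ ≤ D k := by
    intro θ hθ k
    have h1 := hcd θ hθ k
    have h2 := hcd θ hθ (k + 1)
    have h3 : A * δ / 2 ^ (k + 1) / 2 ≤ A * δ / 2 ^ k / 2 := by
      gcongr <;> norm_num
    have h4 := norm_sub_le_norm_sub_add_norm_sub (c θ k) θ (c θ (k + 1))
    rw [norm_sub_rev θ] at h4
    simp only [D]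
    linarith
  have hlim : ∀ θ ∈ S, Tendsto (c θ) atTop (𝓝 θ) := by
    intro θ hθ
    rw [tendsto_iff_norm_sub_tendsto_zero]
    refine squeeze_zero (fun _ => norm_nonneg _) (hcd θ hθ) ?_
    have : Tendsto (fun k : ℕ => A * δ / 2 * (1 / 2 : ℝ) ^ k) atTop (𝓝 (A * δ / 2 * 0)) :=
      (tendsto_pow_atTop_nhds_zero_of_lt_one (by norm_num) (by norm_num)).const_mul _
    rw [mul_zero] at this
    refine this.congr fun k => ?_
    rw [one_div, inv_pow]; field_simp
  let I : ℕ → Finset (E d × E d) := fun k =>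
    (T k ×ˢ T (k + 1)).filter fun q => q.1 ∈ S ∧ q.2 ∈ S ∧ ‖q.1 - q.2‖ ≤ D k
  let B : ℕ → Set Ω := fun k => ⋃ q ∈ I k, {ω | s k ≤ |G q.1 ω - G q.2 ω|}
  have hBk : ∀ k, P (B k) ≤ ENNReal.ofReal (2 * ρ ^ (k + 1)) := by
    intro k
    have hexp : ∀ q ∈ I k, P {ω | s k ≤ |G q.1 ω - G q.2 ω|}
        ≤ ENNReal.ofReal (2 * Real.exp (-w) ^ (k + 1)) := by
      intro q hq
      obtain ⟨-, h1, h2, h3⟩ := Finset.mem_filter.1 hq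
      refine (hG _ h1 _ h2 (D k) (hD k) h3 (s k) (hs k)).trans (ENNReal.ofReal_le_ofReal ?_)
      rw [← Real.exp_nat_mul]
      gcongr
      have e : -s k ^ 2 / (2 * (σ * D k) ^ 2) = -(w * (9 / 4) ^ k) := by
        simp only [s, D, hw, chainConst]
        change _ = -(u ^ 2 / (32 * A ^ 2) * _)
        have h49 : ((3 : ℝ) / 4) ^ k * 2 ^ k = (3 / 2) ^ k := by rw [← mul_pow]; norm_num
        have h94 : ((9 : ℝ) / 4) ^ k = (3 / 2) ^ k * (3 / 2) ^ k := by
          rw [← mul_pow]; norm_num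
        rw [h94, ← h49]
        field_simp
        ring
      rw [e]
      -- Bernoulli's inequality weakens the exponent to `w * (k + 1)`, so that it pairs with the
      -- `(16 ^ d) ^ (k + 1)` links into the power `ρ ^ (k + 1)`.
      have hb : (1 : ℝ) + k * (5 / 4) ≤ (1 + 5 / 4) ^ k :=
        one_add_mul_le_pow (by norm_num) k
      have hw0 : 0 ≤ w := div_nonneg (sq_nonneg u) (by have := chainConst_pos d; positivity)
      have hk : (0 : ℝ) ≤ k := Nat.cast_nonneg k
      have hb' : (k : ℝ) + 1 ≤ (9 / 4) ^ k := by
        norm_num at hb; linarith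
      have := mul_le_mul_of_nonneg_left hb' hw0
      push_cast
      linarith
    have hcard : ((I k).card : ℝ) ≤ (16 ^ d) ^ (k + 1) := by
      have h1 : (I k).card ≤ (4 ^ k) ^ d * (4 ^ (k + 1)) ^ d := by
        refine (Finset.card_filter_le _ _).trans ?_
        rw [Finset.card_product]
        exact Nat.mul_le_mul (hTcard k) (hTcard (k + 1))
      have h2 : (4 ^ k) ^ d * (4 ^ (k + 1)) ^ d ≤ (16 ^ d) ^ (k + 1) := by
        rw [← mul_pow, ← pow_mul, mul_comm d, pow_mul]
        refine Nat.pow_le_pow_left ?_ d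
        rw [show 16 = 4 * 4 by norm_num, mul_pow]
        gcongr <;> omega
      exact_mod_cast h1.trans h2
    calc P (B k) ≤ ∑ q ∈ I k, P {ω | s k ≤ |G q.1 ω - G q.2 ω|} :=
          measure_biUnion_finset_le _ _
      _ ≤ ∑ _q ∈ I k, ENNReal.ofReal (2 * Real.exp (-w) ^ (k + 1)) := Finset.sum_le_sum hexp
      _ = ENNReal.ofReal ((I k).card * (2 * Real.exp (-w) ^ (k + 1))) := by
          rw [Finset.sum_const, nsmul_eq_mul, ENNReal.ofReal_mul (Nat.cast_nonneg _),
            ENNReal.ofReal_natCast]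
      _ ≤ ENNReal.ofReal (2 * ρ ^ (k + 1)) := by
          refine ENNReal.ofReal_le_ofReal ?_
          rw [hρ, mul_pow, mul_left_comm 2]
          gcongr
  have hsub : {ω | ∃ θ ∈ S, u * δ * σ < |G θ ω - G θ₀ ω|}
      ⊆ (⋃ k, B k) ∪ {ω | ¬ ContinuousOn (fun θ => G θ ω) S} := by
    rintro ω ⟨θ, hθ, hlt⟩
    by_contra hcon
    simp only [Set.mem_union, Set.mem_iUnion, Set.mem_ofPred_eq, not_or, not_exists,
      not_not, B] at hcon
    obtain ⟨hB, hc⟩ := hcon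
    have := abs_sub_le_of_chain hc hθ (hcS θ hθ) (hlim θ hθ) (a := u * δ * σ / 4)
      (by positivity) (fun k => (not_le.1 (hB k (c θ k, c θ (k + 1)) ?_)).le)
    · change |G θ ω - G θ₀ ω| ≤ _ at this
      linarith
    · exact Finset.mem_filter.2 ⟨Finset.mk_mem_product (hcT θ hθ k) (hcT θ hθ (k + 1)),
        hcS θ hθ k, hcS θ hθ (k + 1), hlink θ hθ k⟩
  calc P {ω | ∃ θ ∈ S, u * δ * σ < |G θ ω - G θ₀ ω|}
      ≤ P (⋃ k, B k) + P {ω | ¬ ContinuousOn (fun θ => G θ ω) S} :=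
        (measure_mono hsub).trans (measure_union_le _ _)
    _ = P (⋃ k, B k) := by rw [ae_iff.1 hcont, add_zero]
    _ ≤ ∑' k, P (B k) := measure_iUnion_le _
    _ ≤ ∑' k, ENNReal.ofReal (2 * ρ ^ (k + 1)) := ENNReal.tsum_le_tsum hBk
    _ ≤ ENNReal.ofReal (2 * 2 * ρ) :=
        tsum_ofReal_geometric_le (by norm_num) (by positivity) hsmall
    _ = ENNReal.ofReal (4 * ρ) := by norm_num

/-- **Peeling**: a process with sub-Gaussian increments of scale `σ` and continuous paths
dominates a quadratic only within distance `O_P(σ)` of the centre. -/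
theorem exists_measure_quadratic_le (d : ℕ) {κ ε : ℝ} (hκ : 0 < κ) (hε : 0 < ε) :
    ∃ M : ℝ, 0 < M ∧ ∀ {Ω : Type u} [MeasurableSpace Ω] (P : Measure Ω) [IsProbabilityMeasure P]
      (G : E d → Ω → ℝ) (S : Set (E d)) (σ : ℝ), 0 < σ → SubGaussianIncrements P G S σ →
      (∀ᵐ ω ∂P, ContinuousOn (fun θ => G θ ω) S) → ∀ θ₀ ∈ S,
      P {ω | ∃ θ ∈ S, M * σ < ‖θ - θ₀‖ ∧ κ * ‖θ - θ₀‖ ^ 2 ≤ |G θ ω - G θ₀ ω|}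
        ≤ ENNReal.ofReal ε := by
  have hA := chainConst_pos d
  obtain ⟨M, hM, hM1, hM2⟩ : ∃ M : ℝ, 0 < M ∧
      Real.exp (-((κ * M / 4) ^ 2 / (32 * chainConst d))) ≤ 1 / 2 ∧
      8 * 16 ^ d * Real.exp (-((κ * M / 4) ^ 2 / (32 * chainConst d))) ≤ ε := by
    have hq : Tendsto (fun M : ℝ => Real.exp (-((κ * M / 4) ^ 2 / (32 * chainConst d))))
        atTop (𝓝 0) := by
      refine Real.tendsto_exp_neg_atTop_nhds_zero.comp ?_
      refine Tendsto.atTop_div_const (by positivity) ((tendsto_pow_atTop two_ne_zero).comp ?_)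
      exact (tendsto_id.const_mul_atTop hκ).atTop_div_const (by norm_num)
    have hq' := hq.const_mul (8 * 16 ^ d)
    rw [mul_zero] at hq'
    obtain ⟨M, h1, h2, h3⟩ := ((eventually_gt_atTop 0).and ((hq.eventually_le_const
      (by norm_num : (0 : ℝ) < 1 / 2)).and (hq'.eventually_le_const hε))).exists
    exact ⟨M, h1, h2, h3⟩
  set r := Real.exp (-((κ * M / 4) ^ 2 / (32 * chainConst d))) with hr
  refine ⟨M, hM, fun {Ω} _ P _ G S σ hσ hG hcont θ₀ h₀ => ?_⟩
  -- Shell `j` has inner radius `2 ^ j * (M * σ)` and outer radius `δ j`. The quadratic there is at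
  -- least `κ` times the squared inner radius, twice the threshold in `B j`; the spare factor two
  -- gives the strict inequality.
  let δ : ℕ → ℝ := fun j => M * σ * 2 ^ (j + 1)
  have hδ : ∀ j, 0 < δ j := fun j => by positivity
  let Sj : ℕ → Set (E d) := fun j => S ∩ {θ | ‖θ - θ₀‖ ≤ δ j}
  let B : ℕ → Set Ω := fun j =>
    {ω | ∃ θ ∈ Sj j, (κ * M / 4 * 2 ^ j) * δ j * σ < |G θ ω - G θ₀ ω|}
  have hB : ∀ j, P (B j) ≤ ENNReal.ofReal (4 * 16 ^ d * r ^ (j + 1)) := by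
    intro j
    refine (measure_exists_lt_abs_sub_le (S := Sj j) hσ
      (fun θ h θ' h' => hG θ h.1 θ' h'.1)
      (hcont.mono fun ω h => h.mono Set.inter_subset_left)
      ⟨h₀, by simpa using (hδ j).le⟩ (hδ j) (fun θ h => h.2) (by positivity)).trans
      (ENNReal.ofReal_le_ofReal ?_)
    rw [mul_assoc, hr, ← Real.exp_nat_mul]
    gcongr
    have hb : (1 : ℝ) + j * 3 ≤ (1 + 3) ^ j := one_add_mul_le_pow (by norm_num) j
    have hj : (0 : ℝ) ≤ j := Nat.cast_nonneg j
    have e : (κ * M / 4 * 2 ^ j) ^ 2 / (32 * chainConst d)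
        = (κ * M / 4) ^ 2 / (32 * chainConst d) * (1 + 3) ^ j := by
      rw [mul_pow (κ * M / 4), ← pow_mul, mul_comm j, pow_mul]; norm_num; ring
    rw [e]
    have h0 : 0 ≤ (κ * M / 4) ^ 2 / (32 * chainConst d) := by positivity
    have := mul_le_mul_of_nonneg_left (show (j : ℝ) + 1 ≤ (1 + 3) ^ j by linarith) h0
    push_cast
    linarith
  have hsub : {ω | ∃ θ ∈ S, M * σ < ‖θ - θ₀‖ ∧ κ * ‖θ - θ₀‖ ^ 2 ≤ |G θ ω - G θ₀ ω|}
      ⊆ ⋃ j, B j := by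
    rintro ω ⟨θ, hθ, hlt, hle⟩
    have hMσ : 0 < M * σ := by positivity
    obtain ⟨j, hj1, hj2⟩ := exists_nat_pow_near (y := (2 : ℝ)) ((one_le_div hMσ).2 hlt.le)
      one_lt_two
    rw [le_div_iff₀ hMσ] at hj1
    rw [div_lt_iff₀ hMσ] at hj2
    refine Set.mem_iUnion.2 ⟨j, θ, ⟨hθ, ?_⟩, lt_of_lt_of_le ?_ hle⟩
    · change ‖θ - θ₀‖ ≤ M * σ * 2 ^ (j + 1)
      linarith
    · have h2 : 0 < 2 ^ j * (M * σ) := by positivity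
      have h3 : (2 ^ j * (M * σ)) ^ 2 ≤ ‖θ - θ₀‖ ^ 2 := by gcongr
      have e : κ * M / 4 * 2 ^ j * δ j * σ = κ * (2 ^ j * (M * σ)) ^ 2 / 2 := by
        simp only [δ]; rw [pow_succ]; ring
      rw [e]
      have h4 : 0 < κ * (2 ^ j * (M * σ)) ^ 2 := by positivity
      have := mul_le_mul_of_nonneg_left h3 hκ.le
      linarith
  calc _ ≤ ∑' j, P (B j) := (measure_mono hsub).trans (measure_iUnion_le _)
    _ ≤ ∑' j, ENNReal.ofReal (4 * 16 ^ d * r ^ (j + 1)) := ENNReal.tsum_le_tsum hB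
    _ ≤ ENNReal.ofReal (2 * (4 * 16 ^ d) * r) :=
        tsum_ofReal_geometric_le (by positivity) (Real.exp_pos _).le hM1
    _ ≤ ENNReal.ofReal ε := ENNReal.ofReal_le_ofReal (by linarith)

end Chaining

/-! ### Concentration of the empirical risk. -/

section Hoeffding

universe u
variable {d p : ℕ} {loss : Loss d p} {Θ : Set (E d)}

/-- On bounded covariates, the loss is bounded and Lipschitz in the parameter. -/
structure BoundedLipschitzOn (loss : Loss d p) (Θ : Set (E d)) (B K : ℝ) : Prop where
  bound : ∀ θ ∈ Θ, ∀ x : E p, ‖x‖ ≤ B → ∀ y, |loss θ x y| ≤ K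
  lipschitz : ∀ θ ∈ Θ, ∀ θ' ∈ Θ, ∀ x : E p, ‖x‖ ≤ B → ∀ y,
    |loss θ x y - loss θ' x y| ≤ K * ‖θ - θ'‖

/-- Boundedness of `Θ` makes the local bounds uniform, and convexity turns the gradient bound into a
Lipschitz bound by the mean value inequality. -/
lemma LossRegular.exists_boundedLipschitzOn (h : LossRegular loss Θ) (hc : Convex ℝ Θ)
    (hb : Bornology.IsBounded Θ) (B : ℝ) : ∃ K : ℝ, 0 < K ∧ BoundedLipschitzOn loss Θ B K := by
  obtain ⟨r, hr⟩ := hb.exists_norm_le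
  obtain ⟨K, hK⟩ := h.bounded (max r B)
  have hK' : ∀ θ ∈ Θ, ∀ x : E p, ‖x‖ ≤ B → ∀ y,
      |loss θ x y| ≤ K ∧ ‖gradient (fun t => loss t x y) θ‖ ≤ K := fun θ hθ x hx y =>
    hK θ hθ ((hr θ hθ).trans (le_max_left _ _)) x (hx.trans (le_max_right _ _)) y
  refine ⟨|K| + 1, by positivity, fun θ hθ x hx y => ?_, fun θ hθ θ' hθ' x hx y => ?_⟩
  · linarith [(hK' θ hθ x hx y).1, le_abs_self K]
  · refine hc.norm_image_sub_le_of_norm_fderiv_le (𝕜 := ℝ) (f := fun t => loss t x y)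
      (fun t ht => h.differentiable t ht x y) (fun t ht => ?_) hθ' hθ
    rw [← toDual_gradient, LinearIsometryEquiv.norm_map]
    linarith [(hK' t ht x hx y).2, le_abs_self K]

lemma BoundedLipschitzOn.integrable {B K : ℝ} (hL : BoundedLipschitzOn loss Θ B K)
    (h : LossRegular loss Θ) {Q : Measure (E p)} [IsFiniteMeasure Q] (hQ : ∀ᵐ x ∂Q, ‖x‖ ≤ B)
    {θ : E d} (hθ : θ ∈ Θ) (y : Fin 2) : Integrable (fun x => loss θ x y) Q :=
  Integrable.of_bound (h.measurable θ hθ y).aestronglyMeasurable K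
    (hQ.mono fun x hx => hL.bound θ hθ x hx y)

lemma BoundedLipschitzOn.classRisk_sub_le {B K : ℝ} (hL : BoundedLipschitzOn loss Θ B K)
    (h : LossRegular loss Θ) {Q : Measure (E p)} [IsProbabilityMeasure Q]
    (hQ : ∀ᵐ x ∂Q, ‖x‖ ≤ B) {θ θ' : E d} (hθ : θ ∈ Θ) (hθ' : θ' ∈ Θ) (y : Fin 2) :
    |classRisk loss Q y θ - classRisk loss Q y θ'| ≤ K * ‖θ - θ'‖ := by
  unfold classRisk
  rw [← integral_sub (hL.integrable h hQ hθ y) (hL.integrable h hQ hθ' y)]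
  have := norm_integral_le_of_norm_le_const (μ := Q) (f := fun x => loss θ x y - loss θ' x y)
    (hQ.mono fun x hx => hL.lipschitz θ hθ θ' hθ' x hx y)
  simpa using this

variable {P0 P1 Psyn : Measure (E p)} {N : ℕ × ℕ} {m : ℕ}

lemma total_eq_card (N : ℕ × ℕ) (m : ℕ) : total N m = Fintype.card (SampleIdx N m) := by
  simp [total, add_assoc]

lemma synRisk_eq_sum (loss : Loss d p) (P0 P1 Psyn : Measure (E p)) (N : ℕ × ℕ) (m : ℕ)
    (θ : E d) : synRisk loss P0 P1 Psyn N m θ = 1 / total N m *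
      ∑ i : SampleIdx N m, classRisk loss (sampleLaw P0 P1 Psyn i) (sampleLabel i) θ := by
  simp [synRisk, prop0, prop1, propSyn, Fintype.sum_sum_type, sampleLaw, sampleLabel]
  ring

section Sample

variable {Ω : Type u} {x : SampleIdx N m → Ω → E p} {B K : ℝ}

instance [IsProbabilityMeasure P0] [IsProbabilityMeasure P1] [IsProbabilityMeasure Psyn]
    (i : SampleIdx N m) : IsProbabilityMeasure (sampleLaw P0 P1 Psyn i) := by
  rcases i with i | i | i <;> simpa [sampleLaw]

lemma ae_sampleLaw (h0 : ∀ᵐ x ∂P0, ‖x‖ ≤ B) (h1 : ∀ᵐ x ∂P1, ‖x‖ ≤ B)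
    (hs : ∀ᵐ x ∂Psyn, ‖x‖ ≤ B) (i : SampleIdx N m) :
    ∀ᵐ x ∂(sampleLaw P0 P1 Psyn i), ‖x‖ ≤ B := by
  rcases i with i | i | i <;> simpa [sampleLaw]

/-- The centred empirical risk. -/
noncomputable def centredRisk (loss : Loss d p) (P0 P1 Psyn : Measure (E p))
    (x : SampleIdx N m → Ω → E p) (θ : E d) (ω : Ω) : ℝ :=
  empRisk loss (fun i => x i ω) θ - synRisk loss P0 P1 Psyn N m θ

lemma centredRisk_eq_sum (θ : E d) (ω : Ω) : centredRisk loss P0 P1 Psyn x θ ω =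
    1 / total N m * ∑ i, (loss θ (x i ω) (sampleLabel i)
      - classRisk loss (sampleLaw P0 P1 Psyn i) (sampleLabel i) θ) := by
  rw [centredRisk, synRisk_eq_sum, empRisk, Finset.sum_sub_distrib, mul_sub]

variable [MeasurableSpace Ω] {Pr : Measure Ω}

lemma ae_norm_sample_le (hlaw : ∀ i, HasLaw (x i) (sampleLaw P0 P1 Psyn i) Pr)
    (hB : ∀ i : SampleIdx N m, ∀ᵐ x ∂(sampleLaw P0 P1 Psyn i), ‖x‖ ≤ B) (i : SampleIdx N m) :
    ∀ᵐ ω ∂Pr, ‖x i ω‖ ≤ B := by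
  have := hB i
  rw [← (hlaw i).map_eq] at this
  exact ae_of_ae_map (hlaw i).aemeasurable this

variable [IsProbabilityMeasure P0] [IsProbabilityMeasure P1] [IsProbabilityMeasure Psyn]

/-- Paths of the centred empirical risk are Lipschitz. -/
lemma ae_continuousOn_centredRisk (h : LossRegular loss Θ) (hL : BoundedLipschitzOn loss Θ B K)
    (hlaw : ∀ i, HasLaw (x i) (sampleLaw P0 P1 Psyn i) Pr)
    (hB : ∀ i : SampleIdx N m, ∀ᵐ x ∂(sampleLaw P0 P1 Psyn i), ‖x‖ ≤ B) :
    ∀ᵐ ω ∂Pr, ContinuousOn (fun θ => centredRisk loss P0 P1 Psyn x θ ω) Θ := by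
  have hcont : ∀ g : E d → ℝ, (∀ θ ∈ Θ, ∀ θ' ∈ Θ, |g θ - g θ'| ≤ K * ‖θ - θ'‖) →
      ContinuousOn g Θ := fun g hg =>
    (LipschitzOnWith.of_dist_le_mul (K := K.toNNReal) fun θ hθ θ' hθ' => by
      rw [Real.dist_eq, dist_eq_norm]
      exact (hg θ hθ θ' hθ').trans
        (mul_le_mul_of_nonneg_right (Real.le_coe_toNNReal K) (norm_nonneg _))).continuousOn
  filter_upwards [ae_all_iff.2 (ae_norm_sample_le hlaw hB)] with ω hω
  simp_rw [centredRisk_eq_sum]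
  refine continuousOn_const.mul (continuousOn_finsetSum _ fun i _ => ContinuousOn.sub ?_ ?_)
  · exact hcont _ fun θ hθ θ' hθ' => hL.lipschitz θ hθ θ' hθ' _ (hω i) _
  · exact hcont _ fun θ hθ θ' hθ' => hL.classRisk_sub_le h (hB i) hθ hθ' _

/-- Hoeffding's inequality for the increments of the centred empirical risk. -/
lemma subGaussianIncrements_centredRisk [IsProbabilityMeasure Pr] (h : LossRegular loss Θ)
    (hL : BoundedLipschitzOn loss Θ B K) (hK : 0 < K)
    (hlaw : ∀ i, HasLaw (x i) (sampleLaw P0 P1 Psyn i) Pr) (hindep : iIndepFun x Pr)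
    (hB : ∀ i : SampleIdx N m, ∀ᵐ x ∂(sampleLaw P0 P1 Psyn i), ‖x‖ ≤ B)
    (hN : 0 < total N m) :
    SubGaussianIncrements Pr (centredRisk loss P0 P1 Psyn x) Θ (K / √(total N m)) := by
  have key : ∀ θ ∈ Θ, ∀ θ' ∈ Θ, ∀ D : ℝ, 0 < D → ‖θ - θ'‖ ≤ D → ∀ s : ℝ, 0 ≤ s →
      Pr {ω | s ≤ centredRisk loss P0 P1 Psyn x θ ω - centredRisk loss P0 P1 Psyn x θ' ω}
        ≤ ENNReal.ofReal (Real.exp (-s ^ 2 / (2 * (K / √(total N m) * D) ^ 2))) := by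
    intro θ hθ θ' hθ' D hD hdist s hs
    let g : SampleIdx N m → E p → ℝ := fun i z =>
      loss θ z (sampleLabel i) - loss θ' z (sampleLabel i)
    have hg : ∀ i, Measurable (g i) := fun i =>
      (h.measurable θ hθ _).sub (h.measurable θ' hθ' _)
    let c : SampleIdx N m → ℝ := fun i => classRisk loss (sampleLaw P0 P1 Psyn i) (sampleLabel i) θ
      - classRisk loss (sampleLaw P0 P1 Psyn i) (sampleLabel i) θ'
    have hmean : ∀ i, Pr[fun ω => g i (x i ω)] = c i := by
      intro i
      have e := (hlaw i).integral_comp (f := g i) (hg i).aestronglyMeasurable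
      change ∫ ω, g i (x i ω) ∂Pr = _ at e
      rw [e]
      exact integral_sub (hL.integrable h (hB i) hθ _) (hL.integrable h (hB i) hθ' _)
    have hsub : ∀ i ∈ (Finset.univ : Finset (SampleIdx N m)),
        HasSubgaussianMGF (fun ω => g i (x i ω) - c i)
        -- Each summand before centring lies in `[-K D, K D]`, so Hoeffding's variance proxy is `(K
        -- D)²`.
        ((‖K * D - -(K * D)‖₊ / 2) ^ 2) Pr := by
      intro i _
      rw [← hmean i]
      refine hasSubgaussianMGF_of_mem_Icc ((hg i).comp_aemeasurable (hlaw i).aemeasurable) ?_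
      filter_upwards [ae_norm_sample_le hlaw hB i] with ω hω
      exact abs_le.1 ((hL.lipschitz θ hθ θ' hθ' _ hω _).trans (by gcongr))
    have hind : iIndepFun (fun i ω => g i (x i ω) - c i) Pr :=
      hindep.comp (fun i z => g i z - c i) fun i => (hg i).sub_const _
    have hoeff := HasSubgaussianMGF.measure_sum_ge_le_of_iIndepFun hind hsub
      (ε := total N m * s) (by positivity)
    have hset : {ω | s ≤ centredRisk loss P0 P1 Psyn x θ ω - centredRisk loss P0 P1 Psyn x θ' ω}
        = {ω | total N m * s ≤ ∑ i, (g i (x i ω) - c i)} := by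
      ext ω
      simp only [Set.mem_ofPred_eq]
      rw [centredRisk_eq_sum, centredRisk_eq_sum, ← mul_sub, ← Finset.sum_sub_distrib,
        one_div, ← div_eq_inv_mul, le_div_iff₀ hN, mul_comm s]
      refine iff_of_eq (congrArg _ (Finset.sum_congr rfl fun i _ => ?_))
      simp only [g, c]
      ring
    rw [hset]
    rw [measureReal_def] at hoeff
    refine (ENNReal.le_ofReal_iff_toReal_le (measure_ne_top _ _) (Real.exp_pos _).le).2
      (hoeff.trans (le_of_eq ?_))
    congr 1
    have hv : (((‖K * D - -(K * D)‖₊ / 2) ^ 2 : NNReal) : ℝ) = (K * D) ^ 2 := by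
      push_cast
      rw [Real.norm_of_nonneg (by nlinarith [mul_pos hK hD])]
      ring
    rw [Finset.sum_const, Finset.card_univ, nsmul_eq_mul, NNReal.coe_mul, hv,
      NNReal.coe_natCast, ← total_eq_card, mul_pow (K / _), div_pow, Real.sq_sqrt hN.le]
    field_simp
  intro θ hθ θ' hθ' D hD hdist s hs
  have hun : {ω | s ≤ |centredRisk loss P0 P1 Psyn x θ ω - centredRisk loss P0 P1 Psyn x θ' ω|}
      ⊆ {ω | s ≤ centredRisk loss P0 P1 Psyn x θ ω - centredRisk loss P0 P1 Psyn x θ' ω}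
      ∪ {ω | s ≤ centredRisk loss P0 P1 Psyn x θ' ω - centredRisk loss P0 P1 Psyn x θ ω} := by
    intro ω hω
    rcases le_abs.1 (show s ≤ |_| from hω) with h1 | h1
    · exact Or.inl h1
    · rw [neg_sub] at h1
      exact Or.inr h1
  refine (measure_mono hun).trans ((measure_union_le _ _).trans ?_)
  rw [two_mul, ENNReal.ofReal_add (Real.exp_pos _).le (Real.exp_pos _).le]
  exact add_le_add (key θ hθ θ' hθ' D hD hdist s hs)
    (key θ' hθ' θ hθ D hD (by rwa [norm_sub_rev]) s hs)

end Sample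

end Hoeffding

/-! ### Bias and statistical error. -/

section Rates

universe u

lemma tendsto_fst_regime : Tendsto (fun N : ℕ × ℕ => N.1) regime atTop :=
  tendsto_fst.mono_left inf_le_left

lemma eventually_lt_regime : ∀ᶠ N : ℕ × ℕ in regime, N.2 < N.1 :=
  mem_inf_of_right (mem_principal_self _)

lemma eventually_pos_regime : ∀ᶠ N : ℕ × ℕ in regime, 0 < (N.1 : ℝ) :=
  (tendsto_fst_regime.eventually_gt_atTop 0).mono fun _ h => Nat.cast_pos.2 h

/-- Allows a single admissible `N` to be chosen when bounding quantities that do not depend on `N`.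
-/
instance : regime.NeBot := by
  rw [regime, prod_atTop_atTop_eq, inf_principal_neBot_iff]
  intro U hU
  obtain ⟨a, ha⟩ := mem_atTop_sets.1 hU
  exact ⟨(a.1 + a.2 + 1, a.2), ha _ ⟨by simp; omega, le_rfl⟩,
    by change a.2 < a.1 + a.2 + 1; omega⟩

lemma le_total (N : ℕ × ℕ) (m : ℕ) : (N.1 : ℝ) ≤ total N m := by
  have h1 : (0 : ℝ) ≤ N.2 := Nat.cast_nonneg _
  have h2 : (0 : ℝ) ≤ m := Nat.cast_nonneg _
  unfold total
  linarith

lemma propSyn_nonneg (N : ℕ × ℕ) (m : ℕ) : 0 ≤ propSyn N m :=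
  div_nonneg (Nat.cast_nonneg _) ((Nat.cast_nonneg _).trans (le_total N m))

section Population

variable {d p : ℕ} {loss : Loss d p} {Θ : Set (E d)} {P0 P1 : Measure (E p)}
  {Psyn : ℕ × ℕ → Measure (E p)} {m : ℕ × ℕ → ℕ} {θs : E d} {θt : ℕ × ℕ → E d}

lemma eventually_synRisk_decomposition (hΘ : IsOpen Θ)
    (hreg : RiskRegular loss Θ P0 P1 Psyn m θs θt) : ∀ᶠ N in regime,
      TwiceDifferentiableOn (synRisk loss P0 P1 (Psyn N) N (m N)) Θ ∧
      ∀ θ ∈ Θ, hess (synRisk loss P0 P1 (Psyn N) N (m N)) θ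
          = hess (balancedRisk loss P0 P1) θ + biasJacobian loss P0 P1 (Psyn N) N (m N) θ ∧
        gradient (synRisk loss P0 P1 (Psyn N) N (m N)) θ
          = gradient (balancedRisk loss P0 P1) θ
            + (prop0 N (m N) - 1 / 2) • gradient (phi loss P0 P1) θ
            + propSyn N (m N) • gradient (psi loss P1 (Psyn N)) θ := by
  filter_upwards [hreg.twice_psi, eventually_pos_regime] with N hpsi hN
  rw [synRisk_eq loss P0 P1 (Psyn N) N (m N) (hN.trans_le (le_total N _)).ne']
  obtain ⟨h1, h2⟩ := TwiceDifferentiableOn.add_mul_add_mul hΘ hreg.twice_balanced hreg.twice_phi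
    hpsi (prop0 N (m N) - 1 / 2) (propSyn N (m N))
  exact ⟨h1, fun θ hθ => ⟨h2 θ hθ, gradient_add_mul_add_mul (hreg.twice_balanced θ hθ).1
    (hreg.twice_phi θ hθ).1 (hpsi θ hθ).1 _ _⟩⟩

/-- At `θs` the Hessian is the fixed `∇²R(θs)` plus a bias Jacobian of norm at most `C`. Comparing
through `θt N` with the Lipschitz condition, on a bounded `Θ`, carries this bound to every `θ`. -/
lemma exists_hess_synRisk_bound (hΘ : IsOpen Θ) (hΘb : Bornology.IsBounded Θ)
    (hs : θs ∈ Θ) (ht : ∀ᶠ N in regime, θt N ∈ Θ)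
    (hreg : RiskRegular loss Θ P0 P1 Psyn m θs θt) : ∃ M : ℝ, 0 < M ∧ ∀ᶠ N in regime,
      ∀ θ ∈ Θ, ‖hess (synRisk loss P0 P1 (Psyn N) N (m N)) θ‖ ≤ M := by
  obtain ⟨L, hL, hlip⟩ := hreg.hess_lipschitz
  obtain ⟨C, hC⟩ := hreg.bias_bounded
  obtain ⟨r, hr⟩ := hΘb.exists_norm_le
  refine ⟨|‖hess (balancedRisk loss P0 P1) θs‖ + C + 2 * (L * (2 * r))| + 1, by positivity, ?_⟩
  filter_upwards [hlip, hC, ht, eventually_synRisk_decomposition hΘ hreg] with N h1 h2 h3 h4 θ hθ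
  set H := hess (synRisk loss P0 P1 (Psyn N) N (m N)) with hH
  have hd : ∀ θ ∈ Θ, ‖H θ - H (θt N)‖ ≤ L * (2 * r) := fun θ hθ =>
    (h1 θ hθ).trans (mul_le_mul_of_nonneg_left
      ((norm_sub_le _ _).trans (by linarith [hr θ hθ, hr _ h3])) hL.le)
  have hHs : ‖H θs‖ ≤ ‖hess (balancedRisk loss P0 P1) θs‖ + C := by
    rw [(h4.2 θs hs).1]
    exact (norm_add_le _ _).trans (by linarith [h2 θs hs])
  have e : H θ = H θs + (H θ - H (θt N)) - (H θs - H (θt N)) := by abel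
  have hn : ‖H θ‖ ≤ ‖H θs‖ + ‖H θ - H (θt N)‖ + ‖H θs - H (θt N)‖ := by
    conv_lhs => rw [e]
    exact (norm_sub_le _ _).trans (add_le_add_left (norm_add_le _ _) _)
  linarith [hd θ hθ, hd θs hs, le_abs_self (‖hess (balancedRisk loss P0 P1) θs‖ + C
    + 2 * (L * (2 * r)))]

/-- The balanced excess risk is at most quadratic in the distance to its minimizer. -/
lemma exists_balancedRisk_sub_le (hΘ : IsOpen Θ) (hΘc : Convex ℝ Θ)
    (hΘb : Bornology.IsBounded Θ) (hs : IsArgmin (balancedRisk loss P0 P1) Θ θs)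
    (ht : ∀ᶠ N in regime, θt N ∈ Θ) (hreg : RiskRegular loss Θ P0 P1 Psyn m θs θt) :
    ∃ C : ℝ, 0 < C ∧ ∀ θ ∈ Θ,
      balancedRisk loss P0 P1 θ - balancedRisk loss P0 P1 θs ≤ C * ‖θ - θs‖ ^ 2 := by
  obtain ⟨M, hM, hM'⟩ := exists_hess_synRisk_bound hΘ hΘb hs.1 ht hreg
  obtain ⟨C, hC⟩ := hreg.bias_bounded
  obtain ⟨μ, hμ, hsc⟩ := hreg.strong_convexity
  -- `R` does not depend on `N`, so one `N` suffices: `∇²R` is `∇²R̃` minus the bias Jacobian.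
  obtain ⟨N, h1, h2, h3⟩ := (hM'.and (hC.and (eventually_synRisk_decomposition hΘ hreg))).exists
  have hC0 : 0 ≤ C := (norm_nonneg _).trans (h2 θs hs.1)
  have hH : ∀ θ ∈ Θ, ‖hess (balancedRisk loss P0 P1) θ‖ ≤ M + C := by
    intro θ hθ
    have e := (h3.2 θ hθ).1
    rw [← sub_eq_iff_eq_add] at e
    rw [← e]
    exact (norm_sub_le _ _).trans (add_le_add (h1 θ hθ) (h2 θ hθ))
  refine ⟨M + C, by positivity, fun θ hθ => ?_⟩
  have hg := norm_gradient_sub_le hΘc hreg.twice_balanced hH hs.1 hθ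
  rw [hs.gradient_eq_zero hΘ, sub_zero] at hg
  have hi := real_inner_le_norm (gradient (balancedRisk loss P0 P1) θ) (θ - θs)
  -- Strong convexity bounds the excess risk by `⟪∇R(θ), θ - θs⟫`, and the gradient is at most `(M +
  -- C) ‖θ - θs‖`.
  have hsc' := hsc θ hθ
  rw [← neg_sub θ θs, inner_neg_right, norm_neg] at hsc'
  have h4 : 0 ≤ μ / 2 * ‖θ - θs‖ ^ 2 := by positivity
  nlinarith [mul_le_mul_of_nonneg_right hg (norm_nonneg (θ - θs))]

/-- Under local symmetry, the distance between the two population minimizers is comparable to the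
discrepancy of the generator weighted by the synthetic proportion. -/
lemma exists_norm_sub_bounds (hΘ : IsOpen Θ) (hΘc : Convex ℝ Θ)
    (hΘb : Bornology.IsBounded Θ) (hs : IsArgmin (balancedRisk loss P0 P1) Θ θs)
    (ht : ∀ᶠ N in regime, IsArgmin (synRisk loss P0 P1 (Psyn N) N (m N)) Θ (θt N))
    (hreg : RiskRegular loss Θ P0 P1 Psyn m θs θt)
    (hsym : gradient (phi loss P0 P1) θs = 0) :
    ∃ a b : ℝ, 0 < a ∧ 0 < b ∧ ∀ᶠ N in regime,
      a * ‖θt N - θs‖ ≤ propSyn N (m N) * ‖gradient (psi loss P1 (Psyn N)) θs‖ ∧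
      propSyn N (m N) * ‖gradient (psi loss P1 (Psyn N)) θs‖ ≤ b * ‖θt N - θs‖ := by
  obtain ⟨M, hM, hM'⟩ := exists_hess_synRisk_bound hΘ hΘb hs.1 (ht.mono fun _ h => h.1) hreg
  obtain ⟨lam, hlam, hlow⟩ := hreg.hess_lower
  refine ⟨lam, M, hlam, hM, ?_⟩
  filter_upwards [hM', hlow, ht, eventually_synRisk_decomposition hΘ hreg] with N h1 h2 h3 h4
  have hg : gradient (synRisk loss P0 P1 (Psyn N) N (m N)) θs
      = propSyn N (m N) • gradient (psi loss P1 (Psyn N)) θs := by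
    rw [(h4.2 θs hs.1).2, hs.gradient_eq_zero hΘ, hsym, smul_zero, zero_add, zero_add]
  have hn : ‖gradient (synRisk loss P0 P1 (Psyn N) N (m N)) θs‖
      = propSyn N (m N) * ‖gradient (psi loss P1 (Psyn N)) θs‖ := by
    rw [hg, norm_smul, Real.norm_of_nonneg (propSyn_nonneg _ _)]
  have ht0 := h3.gradient_eq_zero hΘ
  rw [← hn, norm_sub_rev (θt N)]
  constructor
  · have := mul_sq_norm_le_inner_gradient_sub hΘc (fun θ hθ => (h4.1 θ hθ).2) h2 h3.1 hs.1
    rw [ht0, sub_zero] at this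
    have hi := this.trans (real_inner_le_norm _ _)
    rcases (norm_nonneg (θs - θt N)).eq_or_lt with h0 | h0
    · rw [← h0]; simp
    · refine le_of_mul_le_mul_right ?_ h0
      linarith
  · simpa [ht0] using norm_gradient_sub_le hΘc h4.1 h1 h3.1 hs.1

/-- The empirical minimizer is within `O_P(n₀^{-1/2})` of the minimizer of the synthetic risk. -/
lemma exists_empirical_minimizer_rate (hΘ : IsOpen Θ) (hΘc : Convex ℝ Θ)
    (hΘb : Bornology.IsBounded Θ) [IsProbabilityMeasure P0] [IsProbabilityMeasure P1]
    [∀ N, IsProbabilityMeasure (Psyn N)]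
    (ht : ∀ᶠ N in regime, IsArgmin (synRisk loss P0 P1 (Psyn N) N (m N)) Θ (θt N))
    (hloss : LossRegular loss Θ) (hreg : RiskRegular loss Θ P0 P1 Psyn m θs θt)
    {Ω : ℕ × ℕ → Type u} [∀ N, MeasurableSpace (Ω N)]
    (Pr : ∀ N, Measure (Ω N)) [∀ N, IsProbabilityMeasure (Pr N)]
    (x : ∀ N, SampleIdx N (m N) → Ω N → E p)
    (hx_law : ∀ N i, HasLaw (x N i) (sampleLaw P0 P1 (Psyn N) i) (Pr N))
    (hx_indep : ∀ N, iIndepFun (x N) (Pr N)) (θhat : ∀ N, Ω N → E d)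
    (hθhat : Tendsto
      (fun N => Pr N {ω | ¬ IsArgmin (empRisk loss fun i => x N i ω) Θ (θhat N ω)})
      regime (𝓝 0)) {ε : ℝ} (hε : 0 < ε) :
    ∃ M : ℝ, 0 < M ∧ ∀ᶠ N in regime,
      Pr N {ω | ¬ (θhat N ω ∈ Θ ∧ ‖θhat N ω - θt N‖ ≤ M / √(N.1 : ℝ))} ≤ ENNReal.ofReal ε := by
  obtain ⟨B, hB0, hB1, hBs⟩ := hreg.bounded_support
  obtain ⟨K, hK, hL⟩ := hloss.exists_boundedLipschitzOn hΘc hΘb B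
  obtain ⟨lam, hlam, hlow⟩ := hreg.hess_lower
  obtain ⟨M, hM, hMP⟩ := exists_measure_quadratic_le.{u} d (half_pos hlam) (half_pos hε)
  refine ⟨M * K, by positivity, ?_⟩
  filter_upwards [hBs, hlow, ht, eventually_synRisk_decomposition hΘ hreg, eventually_pos_regime,
    hθhat.eventually_le_const (ENNReal.ofReal_pos.2 (half_pos hε))] with N hBN h2 h3 h4 hN h5
  have hB := ae_sampleLaw (N := N) (m := m N) hB0 hB1 hBN
  have htot : 0 < total N (m N) := hN.trans_le (le_total _ _)
  have hbad := hMP (Pr N) (centredRisk loss P0 P1 (Psyn N) (x N)) Θ (K / √(total N (m N)))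
    (by positivity) (subGaussianIncrements_centredRisk hloss hL hK (hx_law N) (hx_indep N) hB htot)
    (ae_continuousOn_centredRisk hloss hL (hx_law N) hB) (θt N) h3.1
  have hsub : {ω | ¬ (θhat N ω ∈ Θ ∧ ‖θhat N ω - θt N‖ ≤ M * K / √(N.1 : ℝ))}
      ⊆ {ω | ¬ IsArgmin (empRisk loss fun i => x N i ω) Θ (θhat N ω)} ∪
        {ω | ∃ θ ∈ Θ, M * (K / √(total N (m N))) < ‖θ - θt N‖ ∧ lam / 2 * ‖θ - θt N‖ ^ 2
          ≤ |centredRisk loss P0 P1 (Psyn N) (x N) θ ω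
            - centredRisk loss P0 P1 (Psyn N) (x N) (θt N) ω|} := by
    intro ω hω
    by_cases hmin : IsArgmin (empRisk loss fun i => x N i ω) Θ (θhat N ω)
    · refine Or.inr ⟨θhat N ω, hmin.1, ?_, ?_⟩
      · have h6 : M * K / √(N.1 : ℝ) < ‖θhat N ω - θt N‖ :=
          not_le.1 fun h => hω ⟨hmin.1, h⟩
        refine lt_of_le_of_lt ?_ h6
        rw [← mul_div_assoc]
        gcongr
        exact le_total _ _
      · have h6 := half_mul_sq_norm_le_sub hΘc h4.1 h2 h3.1 hmin.1 (h3.gradient_eq_zero hΘ)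
        have h7 : empRisk loss (fun i => x N i ω) (θhat N ω)
            ≤ empRisk loss (fun i => x N i ω) (θt N) := hmin.2 h3.1
        refine le_trans ?_ (neg_le_abs _)
        unfold centredRisk
        linarith
    · exact Or.inl hmin
  calc _ ≤ _ := (measure_mono hsub).trans (measure_union_le _ _)
    _ ≤ ENNReal.ofReal (ε / 2) + ENNReal.ofReal (ε / 2) := add_le_add h5 hbad
    _ = ENNReal.ofReal ε := by
      rw [← ENNReal.ofReal_add (by positivity) (by positivity), add_halves]

end Population

end Rates

/-! ### Comparison of bias with statistical error. -/

section Conclusion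

universe u

section StochasticOrder

variable {Ω : ℕ × ℕ → Type u} [∀ N, MeasurableSpace (Ω N)] {Pr : ∀ N, Measure (Ω N)}
  {X : ∀ N, Ω N → ℝ} {a b : ℕ × ℕ → ℝ}

lemma IsOmegaP.dominatesP (h : IsOmegaP Pr X b) (hab : a =o[regime] b)
    (hb : ∀ᶠ N in regime, 0 < b N) : DominatesP Pr X a := by
  intro K
  rw [ENNReal.tendsto_nhds_zero]
  intro ε hε
  -- `IsOmegaP` takes real levels, while `ε` may be infinite.
  obtain ⟨δ, hδ, hδε⟩ := ENNReal.lt_iff_exists_nnreal_btwn.1 hε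
  obtain ⟨c, hc, hev⟩ := h δ (by exact_mod_cast hδ)
  filter_upwards [hev, hb, (hab.const_mul_left K).bound (half_pos hc)] with N h1 h2 h3
  rw [ENNReal.ofReal_coe_nnreal] at h1
  refine (measure_mono fun ω hω => ?_).trans (h1.trans hδε.le)
  have h4 : X N ω ≤ K * a N := hω
  have h5 : K * a N ≤ c / 2 * b N := by
    refine (le_abs_self _).trans ?_
    rwa [Real.norm_eq_abs, Real.norm_of_nonneg h2.le] at h3
  change X N ω < c * b N
  nlinarith [mul_pos hc h2]

end StochasticOrder

lemma propSyn_mul_le {N : ℕ × ℕ} {m : ℕ} {c g : ℝ} (hN : 0 < (N.1 : ℝ)) (hg : 0 < g)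
    (hm : (m : ℝ) ≤ c * (√(N.1 : ℝ) / g)) : propSyn N m * g ≤ c / √(N.1 : ℝ) := by
  have hs : 0 < √(N.1 : ℝ) := Real.sqrt_pos.2 hN
  have h1 : propSyn N m ≤ m / N.1 := by
    unfold propSyn
    gcongr
    exact le_total N m
  calc propSyn N m * g ≤ m / N.1 * g := by gcongr
    _ ≤ c * (√(N.1 : ℝ) / g) / N.1 * g := by gcongr
    _ = c / √(N.1 : ℝ) := by
      nth_rw 2 [← Real.mul_self_sqrt hN.le]
      field_simp

/-- The total is at most `2 n₀ + m`, hence at most `(2c + 1) m`. -/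
lemma one_div_le_propSyn {N : ℕ × ℕ} {m : ℕ} {c : ℝ} (hc : 0 < c) (hN : 0 < (N.1 : ℝ))
    (hlt : N.2 < N.1) (hm : (N.1 : ℝ) ≤ c * m) : 1 / (2 * c + 1) ≤ propSyn N m := by
  have h1 : (N.2 : ℝ) ≤ N.1 := by exact_mod_cast hlt.le
  unfold propSyn
  rw [div_le_div_iff₀ (by positivity) (hN.trans_le (le_total N m))]
  unfold total
  linarith

end Conclusion

end SynAug

theorem theorem6 {d p : ℕ} (loss : Loss d p)
    -- parameter space: a bounded convex open set, for example an open ball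
    (Θ : Set (E d)) (hΘ_open : IsOpen Θ) (hΘ_convex : Convex ℝ Θ)
    (hΘ_bounded : Bornology.IsBounded Θ)
    -- class-conditional distributions, generator distributions, synthetic sizes
    (P0 P1 : Measure (E p)) [IsProbabilityMeasure P0] [IsProbabilityMeasure P1]
    (Psyn : ℕ × ℕ → Measure (E p)) [∀ N, IsProbabilityMeasure (Psyn N)]
    (m : ℕ × ℕ → ℕ)
    -- population minimizers and regularity
    (θs : E d) (hθs : IsArgmin (balancedRisk loss P0 P1) Θ θs)
    (θt : ℕ × ℕ → E d)
    (hθt : ∀ᶠ N in regime, IsArgmin (synRisk loss P0 P1 (Psyn N) N (m N)) Θ (θt N))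
    (hloss : LossRegular loss Θ)
    (hreg : RiskRegular loss Θ P0 P1 Psyn m θs θt)
    -- independent samples and the empirical minimizer
    {Ω : ℕ × ℕ → Type*} [∀ N, MeasurableSpace (Ω N)]
    (Pr : ∀ N, Measure (Ω N)) [∀ N, IsProbabilityMeasure (Pr N)]
    (x : ∀ N, SampleIdx N (m N) → Ω N → E p)
    (hx_law : ∀ N i, HasLaw (x N i) (sampleLaw P0 P1 (Psyn N) i) (Pr N))
    (hx_indep : ∀ N, iIndepFun (x N) (Pr N))
    (θhat : ∀ N, Ω N → E d)
    (hθhat : Tendsto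
      (fun N => Pr N {ω | ¬ IsArgmin (empRisk loss fun i => x N i ω) Θ (θhat N ω)})
      regime (𝓝 0))
    -- local symmetry
    (hsym : gradient (phi loss P0 P1) θs = 0)
    -- realistic generator
    (hreal_lower : (fun N : ℕ × ℕ => 1 / √(N.1 : ℝ)) =o[regime]
      fun N => ‖gradient (psi loss P1 (Psyn N)) θs‖)
    (hreal_upper : Tendsto (fun N => ‖gradient (psi loss P1 (Psyn N)) θs‖) regime (𝓝 0)) :
    -- diminishing synthetic size
    (((fun N => (m N : ℝ)) =O[regime]
        fun N => √(N.1 : ℝ) / ‖gradient (psi loss P1 (Psyn N)) θs‖) →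
      ((fun N => (m N : ℝ)) =o[regime] fun N => (N.1 : ℝ)) ∧
      IsBigOP Pr
        (fun N ω => balancedRisk loss P0 P1 (θhat N ω) - balancedRisk loss P0 P1 θs)
        (fun N => 1 / (N.1 : ℝ))) ∧
    -- non-diminishing synthetic size
    (((fun N : ℕ × ℕ => (N.1 : ℝ)) =O[regime] fun N => (m N : ℝ)) →
      IsOmegaP Pr
        (fun N ω => balancedRisk loss P0 P1 (θhat N ω) - balancedRisk loss P0 P1 θs)
        (fun N => ‖gradient (psi loss P1 (Psyn N)) θs‖ ^ 2) ∧
      ((fun N : ℕ × ℕ => 1 / (N.1 : ℝ)) =o[regime]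
        fun N => ‖gradient (psi loss P1 (Psyn N)) θs‖ ^ 2) ∧
      DominatesP Pr
        (fun N ω => balancedRisk loss P0 P1 (θhat N ω) - balancedRisk loss P0 P1 θs)
        (fun N => 1 / (N.1 : ℝ))) := by
  obtain ⟨a, b, ha, hb, hab⟩ := exists_norm_sub_bounds hΘ_open hΘ_convex hΘ_bounded hθs hθt hreg hsym
  obtain ⟨C, hC, hupper⟩ := exists_balancedRisk_sub_le hΘ_open hΘ_convex hΘ_bounded hθs
    (hθt.mono fun _ h => h.1) hreg
  obtain ⟨L, hL, hgrowth⟩ := hreg.quadratic_growth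
  have hrate := fun {ε : ℝ} (hε : 0 < ε) => exists_empirical_minimizer_rate hΘ_open hΘ_convex
    hΘ_bounded hθt hloss hreg Pr x hx_law hx_indep θhat hθhat hε
  have hlower : ∀ c : ℝ, 0 < c → ∀ᶠ N in regime,
      1 / √(N.1 : ℝ) ≤ c * ‖gradient (psi loss P1 (Psyn N)) θs‖ := by
    intro c hc
    filter_upwards [hreal_lower.bound hc] with N h
    rwa [Real.norm_of_nonneg (by positivity), norm_norm] at h
  have hpos : ∀ᶠ N in regime, 0 < ‖gradient (psi loss P1 (Psyn N)) θs‖ := by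
    filter_upwards [hlower 1 one_pos, eventually_pos_regime] with N h hN
    rw [one_mul] at h
    exact lt_of_lt_of_le (by positivity) h
  refine ⟨fun hm => ⟨hm.trans_isLittleO ?_, ?_⟩, fun hm => ?_⟩
  · refine IsLittleO.of_bound fun c hc => ?_
    filter_upwards [hlower c hc, hpos, eventually_pos_regime] with N h hg hN
    rw [Real.norm_of_nonneg (by positivity), Real.norm_of_nonneg hN.le, div_le_iff₀ hg]
    have hs : 0 < √(N.1 : ℝ) := Real.sqrt_pos.2 hN
    rw [div_le_iff₀ hs] at h
    calc √(N.1 : ℝ) = 1 * √(N.1 : ℝ) := (one_mul _).symm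
      _ ≤ c * ‖gradient (psi loss P1 (Psyn N)) θs‖ * √(N.1 : ℝ) * √(N.1 : ℝ) := by gcongr
      _ = c * N.1 * ‖gradient (psi loss P1 (Psyn N)) θs‖ := by
        rw [mul_assoc _ (√(N.1 : ℝ)), Real.mul_self_sqrt hN.le]; ring
  · intro ε hε
    obtain ⟨c, hc, hmc⟩ := hm.exists_pos
    obtain ⟨M, hM, hev⟩ := hrate hε
    -- `M` accounts for the statistical error and `c / a` for the bias, both in units of
    -- `n₀^{-1/2}`.
    refine ⟨C * (M + c / a) ^ 2, by positivity, ?_⟩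
    filter_upwards [hev, hab, hmc.bound, hpos, eventually_pos_regime] with N h1 h2 h3 hg hN
    refine (measure_mono fun ω hω hgood => ?_).trans h1
    obtain ⟨hin, hnear⟩ := hgood
    rw [Real.norm_of_nonneg (Nat.cast_nonneg _), Real.norm_of_nonneg (by positivity)] at h3
    have h4 := h2.1.trans (propSyn_mul_le hN hg h3)
    rw [← le_div_iff₀' ha, div_right_comm] at h4
    have h5 : ‖θhat N ω - θs‖ ≤ (M + c / a) / √(N.1 : ℝ) := by
      rw [add_div]
      exact (norm_sub_le_norm_sub_add_norm_sub _ (θt N) _).trans (add_le_add hnear h4)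
    have h6 : 0 ≤ balancedRisk loss P0 P1 (θhat N ω) - balancedRisk loss P0 P1 θs :=
      sub_nonneg.2 (hθs.2 hin)
    rw [Set.mem_ofPred_eq] at hω
    refine absurd hω (not_lt.2 ?_)
    rw [abs_of_nonneg h6]
    calc _ ≤ C * ‖θhat N ω - θs‖ ^ 2 := hupper _ hin
      _ ≤ C * ((M + c / a) / √(N.1 : ℝ)) ^ 2 := by gcongr
      _ = C * (M + c / a) ^ 2 * (1 / N.1) := by
        rw [div_pow, Real.sq_sqrt hN.le]; ring
  · have hsq : (fun N : ℕ × ℕ => 1 / (N.1 : ℝ)) =o[regime]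
        fun N => ‖gradient (psi loss P1 (Psyn N)) θs‖ ^ 2 := by
      refine (hreal_lower.pow two_pos).congr_left fun N => ?_
      rw [div_pow, one_pow, Real.sq_sqrt (Nat.cast_nonneg _)]
    have homega : IsOmegaP Pr
        (fun N ω => balancedRisk loss P0 P1 (θhat N ω) - balancedRisk loss P0 P1 θs)
        (fun N => ‖gradient (psi loss P1 (Psyn N)) θs‖ ^ 2) := by
      intro ε hε
      obtain ⟨c, hc, hmc⟩ := hm.exists_pos
      obtain ⟨M, hM, hev⟩ := hrate hε
      set κ := 1 / (2 * c + 1) / b with hκ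
      have hκ0 : 0 < κ := by positivity
      -- The bias is at least `κ * g`; eventually the statistical error `M / √n₀` consumes at most
      -- half of it.
      refine ⟨L * (κ / 2) ^ 2, by positivity, ?_⟩
      filter_upwards [hev, hab, hmc.bound, eventually_pos_regime, eventually_lt_regime,
        hlower (κ / 2 / M) (by positivity)] with N h1 h2 h3 hN hlt h4
      refine (measure_mono fun ω hω hgood => ?_).trans h1
      obtain ⟨hin, hnear⟩ := hgood
      rw [Real.norm_of_nonneg hN.le, Real.norm_of_nonneg (Nat.cast_nonneg _)] at h3
      set g := ‖gradient (psi loss P1 (Psyn N)) θs‖ with hg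
      have hg0 : 0 ≤ g := norm_nonneg _
      have h5 : κ * g ≤ ‖θt N - θs‖ := by
        have := (mul_le_mul_of_nonneg_right (one_div_le_propSyn hc hN hlt h3) hg0).trans h2.2
        rw [hκ, div_mul_eq_mul_div, div_le_iff₀ hb]
        linarith
      have h6 : M / √(N.1 : ℝ) ≤ κ / 2 * g := by
        have := mul_le_mul_of_nonneg_left h4 hM.le
        rw [mul_one_div] at this
        refine this.trans (le_of_eq ?_)
        field_simp
      have h7 : κ / 2 * g ≤ ‖θhat N ω - θs‖ := by
        have := norm_sub_le_norm_sub_add_norm_sub (θt N) (θhat N ω) θs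
        rw [norm_sub_rev (θt N) (θhat N ω)] at this
        linarith
      refine absurd (show _ < L * (κ / 2) ^ 2 * g ^ 2 from hω) (not_lt.2 ?_)
      calc L * (κ / 2) ^ 2 * g ^ 2 = L * (κ / 2 * g) ^ 2 := by ring
        _ ≤ L * ‖θhat N ω - θs‖ ^ 2 := by gcongr
        _ ≤ _ := hgrowth _ hin
    exact ⟨homega, hsq, homega.dominatesP hsq (hpos.mono fun N h => by positivity)⟩
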